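/- For complex $a,q$ and an integer $m\ge 0$ put $(a;q)_m=\prod_{j=0}^{m-1}(1-aq^j)$, and for $|q|<1$ put $(a;q)_\infty=\prod_{j=0}^{\infty}(1-aq^j)$ and $(a_1,a_2,a_3;q)_\infty=(a_1;q)_\infty(a_2;q)_\infty(a_3;q)_\infty$. Let $q\in\mathbb{C}$ with $|q|<1$. Then the following four double series, summed over all integers $n,r\ge 0$, converge absolutely, and $$\sum_{n,r\ge 0}\frac{(-1)^n q^{3n^2+4n+4nr+\frac52 r^2+\frac72 r}}{(-q;q)_{2n+2r+2}\,(q;q)_r\,(q;q^2)_{r+1}\,(q^2;q^2)_n}=\frac{(q^2,q^{16},q^{18};q^{18})_\infty}{(q^2;q^2)_\infty},$$ $$\sum_{n,r\ge 0}\frac{(-1)^n q^{3n^2+4n+4nr+\frac52 r^2+\frac32 r}\,\bigl(q^{2r+2}-q+q^r+q^{r+1}\bigr)}{(-q;q)_{2n+2r+2}\,(q;q)_r\,(q;q^2)_{r+1}\,(q^2;q^2)_n}=\frac{(q^4,q^{14},q^{18};q^{18})_\infty}{(q^2;q^2)_\infty},$$ $$\sum_{n,r\ge 0}\frac{(-1)^n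 q^{3n^2+4nr+\frac52 r^2-\frac52 r}\,\bigl(q^{r}+q^{r+1}-q\bigr)}{(-q;q)_{2n+2r}\,(q;q)_r\,(q;q^2)_{r}\,(q^2;q^2)_n}=\frac{(q^6;q^6)_\infty}{(q^2;q^2)_\infty},$$ $$\sum_{n,r\ge 0}\frac{(-1)^n q^{3n^2+4nr+\frac52 r^2-\frac12 r}}{(-q;q)_{2n+2r}\,(q;q)_r\,(q;q^2)_{r}\,(q^2;q^2)_n}=\frac{(q^8,q^{10},q^{18};q^{18})_\infty}{(q^2;q^2)_\infty}.$$ -/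

import Mathlib

/-- The finite q-shifted factorial `(a;q)_m = ∏_{j=0}^{m-1} (1 - a q^j)`. -/
noncomputable def qPoch (a q : ℂ) (m : ℕ) : ℂ :=
  ∏ j ∈ Finset.range m, (1 - a * q ^ j)

/-- The infinite q-shifted factorial `(a;q)_∞ = ∏_{j≥0} (1 - a q^j)`. -/
noncomputable def qPochInf (a q : ℂ) : ℂ :=
  ∏' j : ℕ, (1 - a * q ^ j)

/-- `(a₁,a₂,a₃;q)_∞ = (a₁;q)_∞ (a₂;q)_∞ (a₃;q)_∞`. -/
noncomputable def qPochInf₃ (a₁ a₂ a₃ q : ℂ) : ℂ :=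
  qPochInf a₁ q * qPochInf a₂ q * qPochInf a₃ q

/-- For `|q| < 1` the infinite product defining `(a;q)_∞` converges. -/
theorem qPochInf_multipliable (a q : ℂ) (hq : ‖q‖ < 1) :
    Multipliable (fun j : ℕ => 1 - a * q ^ j) := by
  have h : Summable (fun j : ℕ => ‖-(a * q ^ j)‖) := by
    simpa [norm_mul, norm_pow] using
      (summable_geometric_of_lt_one (norm_nonneg q) hq).mul_left ‖a‖
  simpa [sub_eq_add_neg] using multipliable_one_add_of_summable h

/-!
Let `F_d(x; u, v) = ∑ᵢ (-1)^i q^(d i(i-1)/2) x^i / ((q;q)_{u-di} (q;q)_{v+di})`. Lowering `u` or `v`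
by one gives two Pascal rules, and the substitutions `i ↦ i + 1` and `i ↦ -i` give a shift and a
reflection in `x`. For `d = 1` these four relations evaluate `F_1(x; n, n)` as a product, and
`n → ∞` is the Jacobi triple product. For `d = 2` and `x ∈ {1, q⁻²}` they determine `F_2(x; r, r)`
and `F_2(x; r, r + 2)` in closed form; this is where the factors `(q;q)_r (q;q²)_r` and the
polynomials in the numerators come from.

By its definition `F_d(x; r, r + s)` is the `β` of a Bailey pair relative to `q^s` whose `α`
consists of theta terms at the positions `d i`. A change of base `q ↦ q²`, resting on the evaluation
at `z = -1` of `∑ₘ z^m q^(m²) / ((q²;q²)_m (q;q)_{u-m} (q;q)_{v-m})`, keeps `α` and replaces `β` by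
a finite sum over `n + r = N`. Weighting by `q^(2(N² + sN))` and summing over `N` by means of Durfee
rectangles gives the double series on the `β` side and, on the `α` side, `1 / (q²;q²)_∞` times a
theta series with nome `q^(d + 4d²) = q^18`, hence a triple product. At `q = 0` only the term
`n = r = 0` survives.
-/

open Filter Finset Topology

/-! ### Shifted factorials -/

theorem qPoch_zero (a q : ℂ) : qPoch a q 0 = 1 := by simp [qPoch]

theorem qPoch_succ (a q : ℂ) (n : ℕ) : qPoch a q (n + 1) = qPoch a q n * (1 - a * q ^ n) := by
  simp [qPoch, prod_range_succ]

theorem qPoch_self_succ (q : ℂ) (n : ℕ) :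
    qPoch q q (n + 1) = qPoch q q n * (1 - q ^ (n + 1)) := by
  rw [qPoch_succ, pow_succ']

theorem qPoch_sq_succ (q : ℂ) (n : ℕ) :
    qPoch q (q ^ 2) (n + 1) = qPoch q (q ^ 2) n * (1 - q ^ (2 * n + 1)) := by
  rw [qPoch_succ, ← pow_mul, pow_succ' q (2 * n)]

theorem qPoch_mul_qPoch_neg (a q : ℂ) (n : ℕ) :
    qPoch a q n * qPoch (-a) q n = qPoch (a ^ 2) (q ^ 2) n := by
  simp only [qPoch, ← prod_mul_distrib]
  exact prod_congr rfl fun j _ => by ring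

theorem qPoch_three_mul (a q : ℂ) (n : ℕ) :
    qPoch a q (3 * n) =
      qPoch a (q ^ 3) n * qPoch (a * q) (q ^ 3) n * qPoch (a * q ^ 2) (q ^ 3) n := by
  induction n with
  | zero => simp [qPoch_zero]
  | succ n ih =>
    rw [show 3 * (n + 1) = 3 * n + 1 + 1 + 1 by ring]
    simp only [qPoch_succ, ih]
    ring

theorem tendsto_qPoch (a : ℂ) {q : ℂ} (hq : ‖q‖ < 1) :
    Tendsto (qPoch a q) atTop (𝓝 (qPochInf a q)) :=
  (qPochInf_multipliable a q hq).hasProd.tendsto_prod_nat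

theorem qPochInf_zero_left (q : ℂ) : qPochInf 0 q = 1 := by simp [qPochInf]

theorem norm_pow_lt_one {q : ℂ} (hq : ‖q‖ < 1) {n : ℕ} (hn : n ≠ 0) : ‖q ^ n‖ < 1 := by
  rw [norm_pow]
  exact pow_lt_one₀ (norm_nonneg q) hq hn

theorem one_sub_pow_ne_zero {q : ℂ} (hq : ‖q‖ < 1) {n : ℕ} (hn : n ≠ 0) : 1 - q ^ n ≠ 0 :=
  sub_ne_zero.2 fun h => by simpa [← h] using norm_pow_lt_one hq hn

theorem qPochInf_trisect (a : ℂ) {q : ℂ} (hq : ‖q‖ < 1) :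
    qPochInf a q = qPochInf₃ a (a * q) (a * q ^ 2) (q ^ 3) := by
  have hq3 : ‖q ^ 3‖ < 1 := norm_pow_lt_one hq three_ne_zero
  refine tendsto_nhds_unique
    ((tendsto_qPoch a hq).comp (tendsto_id.const_mul_atTop' three_pos)) ?_
  exact (((tendsto_qPoch a hq3).mul (tendsto_qPoch (a * q) hq3)).mul
    (tendsto_qPoch (a * q ^ 2) hq3)).congr fun n => (qPoch_three_mul a q n).symm

theorem qPochInf₃_swap (a b c q : ℂ) : qPochInf₃ a b c q = qPochInf₃ b a c q := by
  simp only [qPochInf₃, mul_comm]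

section NormLtOne

variable {a q : ℂ} (ha : ‖a‖ < 1) (hq : ‖q‖ < 1)

include ha hq

theorem one_sub_mul_pow_ne_zero (n : ℕ) : 1 - a * q ^ n ≠ 0 := by
  refine sub_ne_zero.2 fun h => ?_
  have hlt : ‖a * q ^ n‖ < 1 := by
    rw [norm_mul, norm_pow]
    exact mul_lt_one_of_nonneg_of_lt_one_left (norm_nonneg a) ha
      (pow_le_one₀ (norm_nonneg q) hq.le)
  simp [← h] at hlt

theorem qPoch_ne_zero (n : ℕ) : qPoch a q n ≠ 0 :=
  prod_ne_zero_iff.2 fun j _ => one_sub_mul_pow_ne_zero ha hq j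

theorem qPochInf_ne_zero : qPochInf a q ≠ 0 := by
  have hsum : Summable fun j : ℕ => ‖-(a * q ^ j)‖ := by
    simpa [norm_mul, norm_pow] using
      (summable_geometric_of_lt_one (norm_nonneg q) hq).mul_left ‖a‖
  simpa [qPochInf, sub_eq_add_neg] using tprod_one_add_ne_zero_of_summable
    (fun j => by simpa [sub_eq_add_neg] using one_sub_mul_pow_ne_zero ha hq j) hsum

theorem tendsto_inv_qPoch :
    Tendsto (fun n => (qPoch a q n)⁻¹) atTop (𝓝 (qPochInf a q)⁻¹) :=
  (tendsto_qPoch a hq).inv₀ (qPochInf_ne_zero ha hq)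

theorem exists_norm_inv_qPoch_le : ∃ C, ∀ n, ‖(qPoch a q n)⁻¹‖ ≤ C := by
  obtain ⟨C, hC⟩ :=
    (Metric.isBounded_range_of_tendsto _ (tendsto_inv_qPoch ha hq)).exists_norm_le
  exact ⟨C, fun n => hC _ ⟨n, rfl⟩⟩

end NormLtOne

/-- The reciprocal `1 / (q;q)_n`, extended by `0` to negative `n`. The extension keeps the
recurrence `invQFact_sub_one` valid for all integers and cuts bilateral sums down to finite ones. -/
noncomputable def invQFact (q : ℂ) (n : ℤ) : ℂ :=
  if 0 ≤ n then (qPoch q q n.toNat)⁻¹ else 0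

theorem invQFact_natCast (q : ℂ) (n : ℕ) : invQFact q n = (qPoch q q n)⁻¹ := by
  simp [invQFact]

theorem invQFact_zero (q : ℂ) : invQFact q 0 = 1 := by simp [invQFact, qPoch_zero]

theorem invQFact_of_neg (q : ℂ) {n : ℤ} (hn : n < 0) : invQFact q n = 0 := by
  simp [invQFact, hn]

theorem invQFact_sub_one {q : ℂ} (hq : ‖q‖ < 1) (n : ℤ) :
    invQFact q (n - 1) = (1 - q ^ n) * invQFact q n := by
  rcases lt_trichotomy n 0 with hn | rfl | hn
  · rw [invQFact_of_neg q hn, invQFact_of_neg q (by lia), mul_zero]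
  · rw [invQFact_of_neg q (by lia), zpow_zero, sub_self, zero_mul]
  · obtain ⟨m, rfl⟩ : ∃ m : ℕ, n = (m + 1 : ℕ) := ⟨(n - 1).toNat, by lia⟩
    have hm := one_sub_pow_ne_zero hq m.add_one_ne_zero
    rw [Nat.cast_succ, add_sub_cancel_right, ← Nat.cast_succ, invQFact_natCast, invQFact_natCast,
      qPoch_self_succ, zpow_natCast, mul_inv]
    field_simp

theorem exists_norm_invQFact_le {q : ℂ} (hq : ‖q‖ < 1) :
    ∃ C, 0 ≤ C ∧ ∀ n, ‖invQFact q n‖ ≤ C := by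
  obtain ⟨C, hC⟩ := exists_norm_inv_qPoch_le hq hq
  have hC0 : 0 ≤ C := (norm_nonneg _).trans (hC 0)
  refine ⟨C, hC0, fun n => ?_⟩
  rw [invQFact]
  split_ifs
  · exact hC _
  · simpa using hC0

theorem tendsto_invQFact {q : ℂ} (hq : ‖q‖ < 1) :
    Tendsto (invQFact q) atTop (𝓝 (qPochInf q q)⁻¹) := by
  have htoNat : Tendsto Int.toNat atTop atTop := tendsto_atTop.2 fun n => by
    filter_upwards [eventually_ge_atTop (n : ℤ)] with m hm
    lia
  refine ((tendsto_inv_qPoch hq hq).comp htoNat).congr' ?_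
  filter_upwards [eventually_ge_atTop 0] with n hn
  simp [invQFact, hn]

/-! ### Finite theta sums -/

/-- The `i`-th term `(-1)^i p^(i(i-1)/2) x^i` of the theta series of the Jacobi triple product. -/
noncomputable def thetaTerm (p x : ℂ) (i : ℤ) : ℂ :=
  (-1) ^ i * p ^ (i * (i - 1) / 2) * x ^ i

theorem thetaTerm_mul_zpow (p x y : ℂ) (i : ℤ) :
    thetaTerm p x i * y ^ i = thetaTerm p (x * y) i := by
  rw [thetaTerm, thetaTerm, mul_zpow, mul_assoc]

section ThetaTerm

variable {p x : ℂ} (hp0 : p ≠ 0)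

include hp0

theorem thetaTerm_ne_zero (hx : x ≠ 0) (i : ℤ) : thetaTerm p x i ≠ 0 :=
  mul_ne_zero (mul_ne_zero (zpow_ne_zero _ (by norm_num)) (zpow_ne_zero _ hp0))
    (zpow_ne_zero _ hx)

theorem thetaTerm_add_one (hx : x ≠ 0) (i : ℤ) :
    thetaTerm p x (i + 1) = -x * thetaTerm p (x * p) i := by
  have hexp : (i + 1) * (i + 1 - 1) / 2 = i * (i - 1) / 2 + i := by
    rw [show (i + 1) * (i + 1 - 1) = i * (i - 1) + i * 2 by ring,
      Int.add_mul_ediv_right _ _ two_ne_zero]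
  rw [thetaTerm, thetaTerm, hexp, zpow_add₀ hp0, zpow_add_one₀ hx, zpow_add_one₀ (by norm_num),
    mul_zpow]
  ring

theorem thetaTerm_neg (i : ℤ) : thetaTerm p x (-i) = thetaTerm p (p / x) i := by
  have hexp : -i * (-i - 1) / 2 = i * (i - 1) / 2 + i := by
    rw [show -i * (-i - 1) = i * (i - 1) + i * 2 by ring,
      Int.add_mul_ediv_right _ _ two_ne_zero]
  rw [thetaTerm, thetaTerm, hexp, zpow_add₀ hp0, div_zpow, zpow_neg, zpow_neg, ← inv_zpow,
    inv_neg_one]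
  ring

end ThetaTerm

/-- The finite analogue `∑ᵢ (-1)^i q^(d i(i-1)/2) x^i / ((q;q)_{u-di} (q;q)_{v+di})` of a theta
series. For `d = 1` it is evaluated by the finite Jacobi triple product; for `d = 2` and suitable
`x` it supplies the Bailey pairs behind the double series. -/
noncomputable def finiteTheta (d : ℕ) (q x : ℂ) (u v : ℤ) : ℂ :=
  ∑' i : ℤ, thetaTerm (q ^ d) x i * (invQFact q (u - d * i) * invQFact q (v + d * i))

theorem hasSum_finiteTheta {d : ℕ} (hd : 0 < d) (q x : ℂ) (u v : ℤ) :
    HasSum (fun i : ℤ => thetaTerm (q ^ d) x i * (invQFact q (u - d * i) * invQFact q (v + d * i)))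
      (finiteTheta d q x u v) := by
  refine (summable_of_ne_finset_zero (s := Icc (-|v|) |u|) fun i hi => ?_).hasSum
  have hd' : (1 : ℤ) ≤ d := by exact_mod_cast hd
  rw [mem_Icc, not_and_or, not_le, not_le] at hi
  rcases hi with hi | hi
  · rw [invQFact_of_neg q (n := v + d * i), mul_zero, mul_zero]
    nlinarith [hd', le_abs_self v, abs_nonneg v]
  · rw [invQFact_of_neg q (n := u - d * i), zero_mul, mul_zero]
    nlinarith [hd', le_abs_self u, abs_nonneg u]

theorem finiteTheta_zero_zero {d : ℕ} (hd : 0 < d) (q x : ℂ) : finiteTheta d q x 0 0 = 1 := by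
  rw [finiteTheta, tsum_eq_single 0]
  · simp [thetaTerm, invQFact_zero]
  · intro i hi
    have hd' : (0 : ℤ) < d := by exact_mod_cast hd
    rcases lt_or_gt_of_ne hi with hi | hi
    · rw [zero_add, invQFact_of_neg q (mul_neg_of_pos_of_neg hd' hi), mul_zero, mul_zero]
    · rw [zero_sub, invQFact_of_neg q (neg_neg_of_pos (mul_pos hd' hi)), zero_mul, mul_zero]

section FiniteTheta

variable {d : ℕ} {q : ℂ} (h0 : q ≠ 0)

include h0

theorem finiteTheta_swap (x : ℂ) (u v : ℤ) :
    finiteTheta d q x u v = finiteTheta d q (q ^ d / x) v u := by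
  rw [finiteTheta, ← (Equiv.neg ℤ).tsum_eq, finiteTheta]
  refine tsum_congr fun i => ?_
  rw [Equiv.neg_apply, thetaTerm_neg (pow_ne_zero d h0), mul_neg, sub_neg_eq_add, ← sub_eq_add_neg,
    mul_comm (invQFact q (u + _))]

theorem finiteTheta_shift {x : ℂ} (hx : x ≠ 0) (u v : ℤ) :
    finiteTheta d q x u v = -x * finiteTheta d q (x * q ^ d) (u - d) (v + d) := by
  rw [finiteTheta, ← (Equiv.addRight (1 : ℤ)).tsum_eq, finiteTheta, ← tsum_mul_left]
  refine tsum_congr fun i => ?_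
  rw [Equiv.coe_addRight, thetaTerm_add_one (pow_ne_zero d h0) hx,
    show u - d * (i + 1) = u - d - d * i by ring, show v + d * (i + 1) = v + d + d * i by ring]
  ring

variable (hq : ‖q‖ < 1) (hd : 0 < d)

include hq hd

theorem finiteTheta_sub_one_left (x : ℂ) (u v : ℤ) :
    finiteTheta d q x (u - 1) v =
      finiteTheta d q x u v - q ^ u * finiteTheta d q (x / q ^ d) u v := by
  refine (hasSum_finiteTheta hd q x (u - 1) v).unique <|
    ((hasSum_finiteTheta hd q x u v).sub
      ((hasSum_finiteTheta hd q (x / q ^ d) u v).mul_left (q ^ u))).congr_fun fun i => ?_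
  rw [div_eq_mul_inv x, ← thetaTerm_mul_zpow, show u - 1 - d * i = u - d * i - 1 by ring,
    invQFact_sub_one hq, zpow_sub₀ h0, zpow_mul, zpow_natCast, inv_zpow]
  ring

theorem finiteTheta_sub_one_right (x : ℂ) (u v : ℤ) :
    finiteTheta d q x u (v - 1) =
      finiteTheta d q x u v - q ^ v * finiteTheta d q (x * q ^ d) u v := by
  refine (hasSum_finiteTheta hd q x u (v - 1)).unique <|
    ((hasSum_finiteTheta hd q x u v).sub
      ((hasSum_finiteTheta hd q (x * q ^ d) u v).mul_left (q ^ v))).congr_fun fun i => ?_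
  rw [← thetaTerm_mul_zpow, show v - 1 + d * i = v + d * i - 1 by ring,
    invQFact_sub_one hq, zpow_add₀ h0, zpow_mul, zpow_natCast]
  ring

end FiniteTheta

/-! ### The Jacobi triple product -/

section JacobiTripleProduct

variable {q x : ℂ} (h0 : q ≠ 0) (hq : ‖q‖ < 1) (hx : x ≠ 0)

include h0 hq hx

theorem finiteTheta_one_recurrence_right (u v : ℤ) :
    (1 - q ^ (u + v)) * finiteTheta 1 q x u v = (1 - q ^ v / x) * finiteTheta 1 q x u (v - 1) := by
  have hright := finiteTheta_sub_one_right h0 hq one_pos x u v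
  have hleft := finiteTheta_sub_one_left h0 hq one_pos (x * q) u v
  have hshift := finiteTheta_shift (d := 1) h0 hx u (v - 1)
  simp only [pow_one, Nat.cast_one, sub_add_cancel, mul_div_cancel_right₀ x h0]
    at hright hleft hshift
  rw [zpow_add₀ h0]
  field_simp
  linear_combination q ^ v * hshift - x * hright - x * q ^ v * hleft

theorem finiteTheta_one_recurrence_left (u v : ℤ) :
    (1 - q ^ (u + v)) * finiteTheta 1 q x u v =
      (1 - x * q ^ (u - 1)) * finiteTheta 1 q x (u - 1) v := by
  have hright := finiteTheta_one_recurrence_right h0 hq (div_ne_zero h0 hx) v u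
  have hswap (w : ℤ) : finiteTheta 1 q (q / x) v w = finiteTheta 1 q x w v := by
    rw [finiteTheta_swap h0 x, pow_one]
  have hexp : q ^ u / (q / x) = x * q ^ (u - 1) := by
    rw [zpow_sub_one₀ h0]
    field_simp
  rwa [hexp, add_comm v, hswap, hswap] at hright

theorem finite_jacobi_triple_product (n : ℕ) :
    finiteTheta 1 q x n n = qPoch x q n * qPoch (q / x) q n * (qPoch q q (2 * n))⁻¹ := by
  induction n with
  | zero =>
    rw [Nat.cast_zero, finiteTheta_zero_zero one_pos]
    simp [qPoch_zero]
  | succ n ih =>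
    have hleft := finiteTheta_one_recurrence_left h0 hq hx (n + 1) (n + 1)
    have hright := finiteTheta_one_recurrence_right h0 hq hx n (n + 1)
    have heven := one_sub_pow_ne_zero hq (2 * n + 1).add_one_ne_zero
    have hodd := one_sub_pow_ne_zero hq (2 * n).add_one_ne_zero
    rw [show (n + 1 + (n + 1) : ℤ) = (2 * n + 1 + 1 : ℕ) by push_cast; ring,
      add_sub_cancel_right, zpow_natCast, zpow_natCast] at hleft
    rw [show (n + (n + 1) : ℤ) = (2 * n + 1 : ℕ) by push_cast; ring, add_sub_cancel_right, ih,
      zpow_natCast, zpow_add_one₀ h0, zpow_natCast] at hright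
    rw [← mul_right_inj' (mul_ne_zero heven hodd), Nat.cast_succ, mul_right_comm, hleft, mul_assoc,
      mul_comm (finiteTheta _ _ _ _ _), hright, show 2 * (n + 1) = 2 * n + 1 + 1 by ring,
      qPoch_succ x, qPoch_succ (q / x), qPoch_self_succ, qPoch_self_succ, mul_inv, mul_inv]
    field_simp

theorem summable_norm_thetaTerm_natCast : Summable fun n : ℕ => ‖thetaTerm q x n‖ := by
  have hratio : Tendsto (fun n : ℕ => ‖x‖ * ‖q‖ ^ n) atTop (𝓝 0) := by
    simpa using (tendsto_pow_atTop_nhds_zero_of_lt_one (norm_nonneg q) hq).const_mul ‖x‖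
  refine summable_of_ratio_test_tendsto_lt_one zero_lt_one
    (Eventually.of_forall fun n => norm_ne_zero_iff.2 (thetaTerm_ne_zero h0 hx n))
    (hratio.congr fun n => ?_)
  rw [norm_norm, norm_norm, eq_div_iff (norm_ne_zero_iff.2 (thetaTerm_ne_zero h0 hx n)),
    Nat.cast_succ, thetaTerm_add_one h0 hx, ← thetaTerm_mul_zpow, zpow_natCast]
  simp only [norm_mul, norm_neg, norm_pow]
  ring

theorem summable_norm_thetaTerm : Summable fun i : ℤ => ‖thetaTerm q x i‖ := by
  refine summable_int_iff_summable_nat_and_neg.2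
    ⟨summable_norm_thetaTerm_natCast h0 hq hx, ?_⟩
  simpa only [thetaTerm_neg h0] using
    summable_norm_thetaTerm_natCast h0 hq (div_ne_zero h0 hx)

theorem tendsto_finiteTheta_one :
    Tendsto (fun n : ℕ => finiteTheta 1 q x n n) atTop
      (𝓝 (∑' i, thetaTerm q x i * ((qPochInf q q)⁻¹ * (qPochInf q q)⁻¹))) := by
  obtain ⟨C, hC0, hC⟩ := exists_norm_invQFact_le hq
  have hcast := tendsto_natCast_atTop_atTop (R := ℤ)
  simp only [finiteTheta, pow_one, Nat.cast_one, one_mul]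
  refine tendsto_tsum_of_dominated_convergence
    ((summable_norm_thetaTerm h0 hq hx).mul_right (C * C))
    (fun i => (Tendsto.mul ?_ ?_).const_mul _) (Eventually.of_forall fun n i => ?_)
  · exact (tendsto_invQFact hq).comp (tendsto_atTop_add_const_right _ (-i) hcast)
  · exact (tendsto_invQFact hq).comp (tendsto_atTop_add_const_right _ i hcast)
  · rw [norm_mul, norm_mul]
    gcongr
    exacts [hC _, hC _]

theorem jacobi_triple_product :
    HasSum (thetaTerm q x) (qPochInf₃ x (q / x) q q) := by
  have hne := qPochInf_ne_zero hq hq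
  have hfinite := ((tendsto_qPoch x hq).mul (tendsto_qPoch (q / x) hq)).mul
    ((tendsto_inv_qPoch hq hq).comp (tendsto_id.const_mul_atTop' two_pos))
  have hlimit := tendsto_nhds_unique (tendsto_finiteTheta_one h0 hq hx)
    (hfinite.congr fun n => (finite_jacobi_triple_product h0 hq hx n).symm)
  rw [tsum_mul_right] at hlimit
  have hsum : ∑' i, thetaTerm q x i = qPochInf₃ x (q / x) q q := by
    rw [← mul_inv, ← div_eq_mul_inv, ← div_eq_mul_inv,
      div_eq_div_iff (mul_ne_zero hne hne) hne] at hlimit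
    rw [qPochInf₃]
    exact mul_right_cancel₀ hne (by linear_combination hlimit)
  exact hsum ▸ (summable_norm_thetaTerm h0 hq hx).of_norm.hasSum

end JacobiTripleProduct

/-! ### Closed forms for `d = 2` -/

section FiniteThetaTwo

variable {q : ℂ} (h0 : q ≠ 0)

include h0

theorem finiteTheta_pow_self (d : ℕ) (u v : ℤ) :
    finiteTheta d q (q ^ d) u v = finiteTheta d q 1 v u := by
  rw [finiteTheta_swap h0, div_self (pow_ne_zero d h0)]

theorem finiteTheta_one_eq_zero (d : ℕ) (v : ℤ) : finiteTheta d q 1 (v + d) v = 0 := by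
  have hshift := finiteTheta_shift (d := d) h0 one_ne_zero (v + d) v
  rw [add_sub_cancel_right, one_mul, neg_one_mul, finiteTheta_pow_self h0] at hshift
  exact self_eq_neg.1 hshift

variable (hq : ‖q‖ < 1)

include hq

theorem finiteTheta_two_one_sub_one (r : ℤ) :
    finiteTheta 2 q 1 r (r - 1) = (1 - q ^ r) * finiteTheta 2 q 1 r r := by
  rw [finiteTheta_sub_one_right h0 hq two_pos, one_mul, finiteTheta_pow_self h0]
  ring

theorem finiteTheta_two_one_add_two (r : ℤ) :
    finiteTheta 2 q 1 r (r + 2) = finiteTheta 2 q 1 r (r + 1) := by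
  have hright := finiteTheta_sub_one_right h0 hq two_pos 1 r (r + 2)
  have hvanish := finiteTheta_one_eq_zero h0 2 r
  rw [Nat.cast_two] at hvanish
  rw [one_mul, finiteTheta_pow_self h0, hvanish, mul_zero, sub_zero] at hright
  rw [← hright, add_sub_assoc]
  norm_num

theorem finiteTheta_two_one_add_one_left (r : ℤ) :
    finiteTheta 2 q 1 (r + 1) r = q ^ r * finiteTheta 2 q 1 r (r + 1) := by
  have hright := finiteTheta_sub_one_right h0 hq two_pos 1 (r + 1) r
  have hvanish := finiteTheta_one_eq_zero h0 2 (r - 1)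
  rw [Nat.cast_two, show r - 1 + 2 = r + 1 by ring] at hvanish
  rw [one_mul, finiteTheta_pow_self h0, hvanish] at hright
  exact sub_eq_zero.1 hright.symm

theorem finiteTheta_two_one_self (r : ℤ) :
    finiteTheta 2 q 1 r r = (1 - q ^ (2 * r + 1)) * finiteTheta 2 q 1 r (r + 2) := by
  have hright := finiteTheta_sub_one_right h0 hq two_pos 1 r (r + 1)
  rw [add_sub_cancel_right, one_mul, finiteTheta_pow_self h0,
    finiteTheta_two_one_add_one_left h0 hq] at hright
  rw [hright, finiteTheta_two_one_add_two h0 hq, zpow_add_one₀ h0, zpow_add_one₀ h0, two_mul,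
    zpow_add₀ h0]
  ring

theorem finiteTheta_two_one_succ (r : ℤ) :
    (1 - q ^ (r + 1)) * finiteTheta 2 q 1 (r + 1) (r + 1) =
      q ^ r * finiteTheta 2 q 1 r (r + 2) := by
  rw [← finiteTheta_two_one_sub_one h0 hq, add_sub_cancel_right,
    finiteTheta_two_one_add_one_left h0 hq, finiteTheta_two_one_add_two h0 hq]

theorem finiteTheta_two_one_self_eq (r : ℕ) :
    finiteTheta 2 q 1 r r = q ^ r.choose 2 * (qPoch q q r * qPoch q (q ^ 2) r)⁻¹ := by
  induction r with
  | zero =>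
    rw [Nat.cast_zero, finiteTheta_zero_zero two_pos]
    simp [qPoch_zero]
  | succ r ih =>
    have hsucc := finiteTheta_two_one_succ h0 hq r
    have hself := finiteTheta_two_one_self h0 hq r
    have hne := one_sub_pow_ne_zero hq r.add_one_ne_zero
    have hodd := one_sub_pow_ne_zero hq (2 * r).add_one_ne_zero
    rw [ih, show (2 * r + 1 : ℤ) = (2 * r + 1 : ℕ) by push_cast; ring, zpow_natCast] at hself
    rw [← Nat.cast_succ, zpow_natCast, zpow_natCast] at hsucc
    rw [qPoch_self_succ, qPoch_sq_succ, Nat.choose_succ_succ' r 1, Nat.choose_one_right, pow_add,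
      ← mul_right_inj' hne, hsucc, ← mul_right_inj' hodd, mul_left_comm, ← hself, mul_inv, mul_inv]
    field_simp

theorem finiteTheta_two_one_add_two_eq (r : ℕ) :
    finiteTheta 2 q 1 r (r + 2) =
      q ^ r.choose 2 * (qPoch q q r * qPoch q (q ^ 2) (r + 1))⁻¹ := by
  have hself := finiteTheta_two_one_self h0 hq r
  have hodd := one_sub_pow_ne_zero hq (2 * r).add_one_ne_zero
  rw [finiteTheta_two_one_self_eq h0 hq, show (2 * r + 1 : ℤ) = (2 * r + 1 : ℕ) by push_cast; ring,
    zpow_natCast] at hself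
  rw [← mul_right_inj' hodd, ← hself, qPoch_sq_succ, mul_inv, mul_inv, mul_inv]
  field_simp

theorem finiteTheta_two_inv_sq_self (r : ℤ) :
    finiteTheta 2 q (1 / q ^ 2) r r =
      finiteTheta 2 q 1 r r * ((q ^ r + q ^ (r + 1) - q) / q ^ (2 * r)) := by
  have hpascal := finiteTheta_sub_one_left h0 hq two_pos 1 r r
  have hsub := finiteTheta_two_one_sub_one h0 hq r
  have hflip := finiteTheta_two_one_add_one_left h0 hq (r - 1)
  have hr := zpow_ne_zero r h0
  rw [sub_add_cancel, hsub, hpascal, zpow_sub_one₀ h0] at hflip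
  rw [two_mul, zpow_add₀ h0 r r, zpow_add_one₀ h0, mul_div_assoc', eq_div_iff (mul_ne_zero hr hr)]
  field_simp at hflip
  linear_combination hflip

theorem finiteTheta_two_inv_sq_add_two (r : ℤ) :
    finiteTheta 2 q (1 / q ^ 2) r (r + 2) =
      finiteTheta 2 q 1 r (r + 2) *
        ((q ^ (2 * r + 2) - q + q ^ r + q ^ (r + 1)) / q ^ (2 * r)) := by
  have hpascal := finiteTheta_sub_one_left h0 hq two_pos 1 r (r + 2)
  have hpascal' := finiteTheta_sub_one_left h0 hq two_pos 1 (r + 1) r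
  have hshift := finiteTheta_shift (d := 2) h0
    (one_div_ne_zero (pow_ne_zero 2 h0)) (r + 1) r
  have hr := zpow_ne_zero r h0
  have hself := finiteTheta_two_one_self h0 hq r
  rw [Nat.cast_two, show r + 1 - 2 = r - 1 by ring, one_div_mul_cancel (pow_ne_zero 2 h0), hpascal]
    at hshift
  rw [add_sub_cancel_right, finiteTheta_two_one_add_one_left h0 hq, hshift, hself,
    ← finiteTheta_two_one_add_two h0 hq] at hpascal'
  simp only [two_mul, zpow_add₀ h0, zpow_ofNat] at hpascal' ⊢
  field_simp at hpascal' ⊢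
  linear_combination hpascal'

theorem finiteTheta_two_inv_sq_self_eq (r : ℕ) :
    finiteTheta 2 q (1 / q ^ 2) r r = q ^ r.choose 2 * (qPoch q q r * qPoch q (q ^ 2) r)⁻¹ *
      ((q ^ r + q ^ (r + 1) - q) / q ^ (2 * r)) := by
  rw [finiteTheta_two_inv_sq_self h0 hq, finiteTheta_two_one_self_eq h0 hq]
  norm_cast

theorem finiteTheta_two_inv_sq_add_two_eq (r : ℕ) :
    finiteTheta 2 q (1 / q ^ 2) r (r + 2) =
      q ^ r.choose 2 * (qPoch q q r * qPoch q (q ^ 2) (r + 1))⁻¹ *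
        ((q ^ (2 * r + 2) - q + q ^ r + q ^ (r + 1)) / q ^ (2 * r)) := by
  rw [finiteTheta_two_inv_sq_add_two h0 hq, finiteTheta_two_one_add_two_eq h0 hq]
  norm_cast

end FiniteThetaTwo

/-! ### A q-binomial sum and the change of base -/

/-- The finite sum `∑ₘ z^m q^(m²) / ((q²;q²)_m (q;q)_{u-m} (q;q)_{v-m})`. Its evaluation at
`z = -1` is the summation behind the change of base `q ↦ q²` of a Bailey pair. -/
noncomputable def mixedBaseSum (q z : ℂ) (u v : ℤ) : ℂ :=
  ∑' m : ℤ, z ^ m * q ^ (m ^ 2) *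
    (invQFact (q ^ 2) m * (invQFact q (u - m) * invQFact q (v - m)))

theorem hasSum_mixedBaseSum (q z : ℂ) (u v : ℤ) :
    HasSum (fun m : ℤ => z ^ m * q ^ (m ^ 2) *
      (invQFact (q ^ 2) m * (invQFact q (u - m) * invQFact q (v - m)))) (mixedBaseSum q z u v) := by
  refine (summable_of_ne_finset_zero (s := Icc 0 u) fun m hm => ?_).hasSum
  rw [mem_Icc, not_and_or, not_le, not_le] at hm
  rcases hm with hm | hm
  · rw [invQFact_of_neg _ hm, zero_mul, mul_zero]
  · rw [invQFact_of_neg q (sub_neg.2 hm), zero_mul, mul_zero, mul_zero]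

theorem mixedBaseSum_comm (q z : ℂ) (u v : ℤ) : mixedBaseSum q z u v = mixedBaseSum q z v u := by
  simp only [mixedBaseSum, mul_comm (invQFact q (u - _))]

theorem mixedBaseSum_eq_zero_of_neg_left (q z : ℂ) {u : ℤ} (hu : u < 0) (v : ℤ) :
    mixedBaseSum q z u v = 0 := by
  refine (hasSum_mixedBaseSum q z u v).unique <| hasSum_zero.congr_fun fun m => ?_
  rcases lt_or_ge m 0 with hm | hm
  · rw [invQFact_of_neg _ hm, zero_mul, mul_zero]
  · rw [invQFact_of_neg q (n := u - m) (by lia), zero_mul, mul_zero, mul_zero]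

section MixedBaseSum

variable {q z : ℂ} (h0 : q ≠ 0) (hq : ‖q‖ < 1)

include h0 hq

theorem mixedBaseSum_sub_one_left (u v : ℤ) :
    mixedBaseSum q z (u - 1) v = mixedBaseSum q z u v - q ^ u * mixedBaseSum q (z / q) u v := by
  refine (hasSum_mixedBaseSum q z (u - 1) v).unique <| ((hasSum_mixedBaseSum q z u v).sub
    ((hasSum_mixedBaseSum q (z / q) u v).mul_left (q ^ u))).congr_fun fun m => ?_
  rw [sub_right_comm, invQFact_sub_one hq, zpow_sub₀ h0, div_zpow]
  ring

theorem mixedBaseSum_sub_mixedBaseSum_mul_sq (hz : z ≠ 0) (u v : ℤ) :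
    mixedBaseSum q z u v - mixedBaseSum q (z * q ^ 2) u v =
      z * q * mixedBaseSum q (z * q ^ 2) (u - 1) (v - 1) := by
  have hshift := (Equiv.subRight (1 : ℤ)).hasSum_iff.2
    (hasSum_mixedBaseSum q (z * q ^ 2) (u - 1) (v - 1))
  refine ((hasSum_mixedBaseSum q z u v).sub (hasSum_mixedBaseSum q (z * q ^ 2) u v)).unique <|
    (hshift.mul_left (z * q)).congr_fun fun m => ?_
  have hz2 : z * q ^ 2 ≠ 0 := mul_ne_zero hz (pow_ne_zero 2 h0)
  rw [Function.comp_apply, Equiv.subRight_apply, invQFact_sub_one (norm_pow_lt_one hq two_ne_zero),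
    sub_sub_sub_cancel_right, sub_sub_sub_cancel_right, zpow_sub_one₀ hz2,
    show (m - 1) ^ 2 = m ^ 2 - 2 * m + 1 by ring, zpow_add_one₀ h0, zpow_sub₀ h0, mul_zpow,
    zpow_mul, zpow_ofNat]
  have := zpow_ne_zero m (pow_ne_zero 2 h0)
  field_simp

theorem mixedBaseSum_neg_one_recurrence (u v : ℤ) :
    (1 + q ^ (u + v)) * mixedBaseSum q (-1) (u - 1) v =
      (1 - q ^ (2 * u)) * mixedBaseSum q (-1) u v := by
  have hneg_one := mixedBaseSum_sub_one_left (z := -1) h0 hq u v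
  have hneg_q := mixedBaseSum_sub_one_left (z := -q) h0 hq u v
  have hneg_q' := mixedBaseSum_sub_one_left (z := -q) h0 hq v (u - 1)
  have hdiff := mixedBaseSum_sub_mixedBaseSum_mul_sq h0 hq
    (div_ne_zero (neg_ne_zero.2 one_ne_zero) h0) u v
  rw [neg_div, div_self h0] at hneg_q hneg_q'
  rw [mixedBaseSum_comm, mixedBaseSum_comm q _ v, mixedBaseSum_comm q _ v] at hneg_q'
  rw [div_mul_cancel₀ _ h0, show -1 / q * q ^ 2 = -q by field_simp] at hdiff
  have hhalf : mixedBaseSum q (-1 / q) u v =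
      q ^ u * mixedBaseSum q (-1) u v + q ^ v * mixedBaseSum q (-1) (u - 1) v := by
    linear_combination hdiff - hneg_q - hneg_q'
  rw [hhalf] at hneg_one
  rw [zpow_add₀ h0, two_mul, zpow_add₀ h0]
  linear_combination hneg_one

omit h0 in
theorem mixedBaseSum_neg_one_zero_left (n : ℕ) :
    mixedBaseSum q (-1) 0 n = qPoch (-q) q n * invQFact (q ^ 2) n := by
  rw [mixedBaseSum, tsum_eq_single 0 fun m hm => ?_]
  · have hq2 := qPoch_mul_qPoch_neg q q n
    have hne := qPoch_ne_zero hq hq n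
    have hne' := qPoch_ne_zero (norm_pow_lt_one hq two_ne_zero) (norm_pow_lt_one hq two_ne_zero) n
    simp only [sub_zero, invQFact_zero, zpow_zero, one_mul, invQFact_natCast, ne_eq,
      OfNat.ofNat_ne_zero, not_false_eq_true, zero_pow]
    field_simp
    linear_combination -hq2
  · rcases lt_or_gt_of_ne hm with hm | hm
    · rw [invQFact_of_neg _ hm, zero_mul, mul_zero]
    · rw [zero_sub, invQFact_of_neg q (neg_neg_of_pos hm), zero_mul, mul_zero, mul_zero]

theorem mixedBaseSum_neg_one_natCast (u v : ℕ) :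
    mixedBaseSum q (-1) u v =
      qPoch (-q) q (u + v) * (invQFact (q ^ 2) u * invQFact (q ^ 2) v) := by
  induction u with
  | zero => rw [Nat.cast_zero, mixedBaseSum_neg_one_zero_left hq, invQFact_zero, one_mul, zero_add]
  | succ u ih =>
    have hrec := mixedBaseSum_neg_one_recurrence h0 hq (u + 1 : ℕ) v
    have hinv := invQFact_sub_one (norm_pow_lt_one hq two_ne_zero) (u + 1 : ℕ)
    have hne := one_sub_pow_ne_zero hq (mul_ne_zero two_ne_zero u.add_one_ne_zero)
    rw [Nat.cast_add_one, add_sub_cancel_right, ← Nat.cast_add_one, zpow_natCast, ← pow_mul] at hinv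
    rw [Nat.cast_add_one, add_sub_cancel_right, ← Nat.cast_add_one, ih, hinv, ← Nat.cast_add,
      zpow_natCast, show (2 * (u + 1 : ℕ) : ℤ) = (2 * (u + 1) : ℕ) by push_cast; ring,
      zpow_natCast] at hrec
    rw [← mul_right_inj' hne, ← hrec, add_right_comm u 1 v, qPoch_succ]
    ring

theorem mixedBaseSum_neg_one_eq {u v : ℤ} {n : ℕ} (huv : u + v = n) :
    mixedBaseSum q (-1) u v =
      qPoch (-q) q n * (invQFact (q ^ 2) u * invQFact (q ^ 2) v) := by
  rcases lt_or_ge u 0 with hu | hu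
  · rw [mixedBaseSum_eq_zero_of_neg_left q _ hu, invQFact_of_neg _ hu, zero_mul, mul_zero]
  rcases lt_or_ge v 0 with hv | hv
  · rw [mixedBaseSum_comm, mixedBaseSum_eq_zero_of_neg_left q _ hv, invQFact_of_neg _ hv, mul_zero,
      mul_zero]
  lift u to ℕ using hu
  lift v to ℕ using hv
  rw [mixedBaseSum_neg_one_natCast h0 hq, show n = u + v by exact_mod_cast huv.symm]

end MixedBaseSum

/-- `(α, β)` is a Bailey pair relative to `q ^ s`, written bilaterally: the coefficient `α i` sits
at the integer `j i`, and positions `j` and `-j - s` carry the same kernel. -/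
def IsBaileyPair {ι : Type*} (q : ℂ) (s : ℕ) (j : ι → ℤ) (α : ι → ℂ) (β : ℕ → ℂ) : Prop :=
  ∀ r : ℕ, HasSum (fun i => α i * (invQFact q (r - j i) * invQFact q (r + s + j i))) (β r)

theorem isBaileyPair_finiteTheta {d : ℕ} (hd : 0 < d) (q x : ℂ) (s : ℕ) :
    IsBaileyPair q s (fun i : ℤ => d * i) (thetaTerm (q ^ d) x)
      fun r => finiteTheta d q x r (r + s) :=
  fun r => hasSum_finiteTheta hd q x r (r + s)

/-- The `(n, r)` term of the double series to which the change of base leads; see `changeBase`. -/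
noncomputable def changeBaseTerm (q : ℂ) (s : ℕ) (β : ℕ → ℂ) (p : ℕ × ℕ) : ℂ :=
  (-1) ^ p.1 * q ^ p.1 ^ 2 * (qPoch (q ^ 2) (q ^ 2) p.1)⁻¹ *
    (qPoch (-q) q (2 * (p.1 + p.2) + s))⁻¹ * β p.2

/-- The sequence `β` of the Bailey pair obtained from a Bailey pair relative to `q ^ s` by the
change of base `q ↦ q²`. -/
noncomputable def changeBase (q : ℂ) (s : ℕ) (β : ℕ → ℂ) (N : ℕ) : ℂ :=
  ∑ p ∈ antidiagonal N, changeBaseTerm q s β p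

theorem sum_antidiagonal_invQFact {q : ℂ} (z : ℂ) {j : ℤ} {s : ℕ} (hj : 0 ≤ j ∨ j + s ≤ 0)
    (N : ℕ) :
    ∑ p ∈ antidiagonal N, z ^ p.1 * q ^ p.1 ^ 2 * (qPoch (q ^ 2) (q ^ 2) p.1)⁻¹ *
      (invQFact q (p.2 - j) * invQFact q (p.2 + s + j)) = mixedBaseSum q z (N - j) (N + s + j) := by
  rw [mixedBaseSum, tsum_eq_sum (s := (range (N + 1)).map Nat.castEmbedding) fun m hm => ?_]
  · rw [sum_map, Nat.sum_antidiagonal_eq_sum_range_succ_mk]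
    refine sum_congr rfl fun m hm => ?_
    have hmN := mem_range_succ_iff.1 hm
    simp only [Nat.castEmbedding_apply, invQFact_natCast, zpow_natCast, Nat.cast_sub hmN]
    rw [← Nat.cast_pow, zpow_natCast, sub_right_comm,
      show (N + s + j - m : ℤ) = N - m + s + j by ring]
    ring
  · rcases lt_or_ge m 0 with hm0 | hm0
    · rw [invQFact_of_neg _ hm0, zero_mul, mul_zero]
    lift m to ℕ using hm0
    have hmN : N < m := by simpa using hm
    rcases hj with hj | hj
    · rw [invQFact_of_neg q (n := N - j - m) (by lia), zero_mul, mul_zero, mul_zero]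
    · rw [invQFact_of_neg q (n := N + s + j - m) (by lia), mul_zero, mul_zero, mul_zero]

theorem IsBaileyPair.isBaileyPair_changeBase {ι : Type*} {q : ℂ} {s : ℕ} {j : ι → ℤ}
    {α : ι → ℂ} {β : ℕ → ℂ} (h : IsBaileyPair q s j α β) (h0 : q ≠ 0) (hq : ‖q‖ < 1)
    (hj : ∀ i, 0 ≤ j i ∨ j i + s ≤ 0) :
    IsBaileyPair (q ^ 2) s j α (changeBase q s β) := by
  intro N
  have hsum := hasSum_sum fun p (_ : p ∈ antidiagonal N) => (h p.2).mul_left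
    ((-1) ^ p.1 * q ^ p.1 ^ 2 * (qPoch (q ^ 2) (q ^ 2) p.1)⁻¹ *
      (qPoch (-q) q (2 * (p.1 + p.2) + s))⁻¹)
  refine hsum.congr_fun fun i => ?_
  have hne : qPoch (-q) q (2 * N + s) ≠ 0 := qPoch_ne_zero (by rwa [norm_neg]) hq _
  have heval := mixedBaseSum_neg_one_eq h0 hq (u := N - j i) (v := N + s + j i) (n := 2 * N + s)
    (by push_cast; ring)
  rw [← inv_mul_eq_iff_eq_mul₀ hne] at heval
  rw [← heval, ← sum_antidiagonal_invQFact (-1) (hj i), mul_sum, mul_sum]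
  exact sum_congr rfl fun p hp => by rw [mem_antidiagonal.1 hp]; ring

/-! ### Durfee rectangles and the limit of a Bailey pair -/

/-- The generating function `q^(M² + tM) / ((q;q)_M (q;q)_{M+t})` of the partitions whose Durfee
rectangle, the largest rectangle with sides of the form `k × (k + t)`, has `k = M`. -/
noncomputable def durfeeTerm (q : ℂ) (t M : ℕ) : ℂ :=
  q ^ (M ^ 2 + t * M) * ((qPoch q q M)⁻¹ * (qPoch q q (M + t))⁻¹)

section Durfee

variable {q : ℂ} (hq : ‖q‖ < 1)

include hq

theorem norm_pow_le_pow {m n : ℕ} (hmn : m ≤ n) : ‖q ^ n‖ ≤ ‖q‖ ^ m := by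
  rw [norm_pow]
  exact pow_le_pow_of_le_one (norm_nonneg q) hq.le hmn

theorem exists_norm_durfeeTerm_le : ∃ C, ∀ t M, ‖durfeeTerm q t M‖ ≤ ‖q‖ ^ M * C := by
  obtain ⟨C, hC⟩ := exists_norm_inv_qPoch_le hq hq
  have hC0 : 0 ≤ C := (norm_nonneg _).trans (hC 0)
  refine ⟨C * C, fun t M => ?_⟩
  rw [durfeeTerm, norm_mul, norm_mul]
  gcongr
  exacts [norm_pow_le_pow hq (by nlinarith), hC _, hC _]

theorem summable_durfeeTerm (t : ℕ) : Summable (durfeeTerm q t) := by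
  obtain ⟨C, hC⟩ := exists_norm_durfeeTerm_le hq
  exact .of_norm_bounded ((summable_geometric_of_lt_one (norm_nonneg q) hq).mul_right C) (hC t)

theorem durfeeTerm_succ (t M : ℕ) :
    durfeeTerm q (t + 1) M =
      q ^ M * durfeeTerm q t M + (1 - q ^ (M + 1)) * durfeeTerm q t (M + 1) := by
  have hM := one_sub_pow_ne_zero hq M.add_one_ne_zero
  have hMt := one_sub_pow_ne_zero hq (M + t).add_one_ne_zero
  have hne := qPoch_ne_zero hq hq M
  have hne' := qPoch_ne_zero hq hq (M + t)
  simp only [durfeeTerm, ← add_assoc, add_right_comm M 1 t, qPoch_self_succ]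
  field_simp
  ring

theorem tsum_durfeeTerm_succ (t : ℕ) :
    ∑' M, durfeeTerm q (t + 1) M = ∑' M, durfeeTerm q t M := by
  have hsum := summable_durfeeTerm hq t
  have hmul : Summable fun M => q ^ M * durfeeTerm q t M := by
    refine .of_norm_bounded hsum.norm fun M => ?_
    rw [norm_mul]
    exact mul_le_of_le_one_left (norm_nonneg _) (by simpa using norm_pow_le_pow hq M.zero_le)
  have hsub : Summable fun M => (1 - q ^ M) * durfeeTerm q t M := by
    simpa only [one_sub_mul] using hsum.sub hmul
  have hzero := hsub.tsum_eq_zero_add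
  rw [pow_zero, sub_self, zero_mul, zero_add] at hzero
  simp only [durfeeTerm_succ hq]
  rw [hmul.tsum_add ((summable_nat_add_iff 1).2 hsub), ← hzero, ← hmul.tsum_add hsub]
  exact tsum_congr fun M => by ring

theorem tendsto_durfeeTerm (M : ℕ) :
    Tendsto (fun t => durfeeTerm q t M) atTop
      (𝓝 (if M = 0 then (qPochInf q q)⁻¹ else 0)) := by
  have hinv : Tendsto (fun t => (qPoch q q (M + t))⁻¹) atTop (𝓝 (qPochInf q q)⁻¹) :=
    (tendsto_inv_qPoch hq hq).comp (tendsto_add_atTop_nat M |>.congr fun t => add_comm t M)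
  rcases eq_or_ne M 0 with rfl | hM
  · simpa [durfeeTerm, qPoch_zero] using hinv
  · have hpow : Tendsto (fun t => q ^ (M ^ 2 + t * M)) atTop (𝓝 0) :=
      squeeze_zero_norm (fun t => norm_pow_le_pow hq
          ((Nat.le_mul_of_pos_right t (Nat.pos_of_ne_zero hM)).trans (Nat.le_add_left _ _)))
        (tendsto_pow_atTop_nhds_zero_of_lt_one (norm_nonneg q) hq)
    simpa [durfeeTerm, hM] using hpow.mul (hinv.const_mul (qPoch q q M)⁻¹)

/-- The sum does not depend on `t`, and only the term `M = 0` survives as `t → ∞`. -/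
theorem hasSum_durfeeTerm (t : ℕ) : HasSum (durfeeTerm q t) (qPochInf q q)⁻¹ := by
  obtain ⟨C, hC⟩ := exists_norm_durfeeTerm_le hq
  have hconst (u : ℕ) : ∑' M, durfeeTerm q u M = ∑' M, durfeeTerm q 0 M := by
    induction u with
    | zero => rfl
    | succ u ih => rw [tsum_durfeeTerm_succ hq, ih]
  have hlim := tendsto_tsum_of_dominated_convergence
    ((summable_geometric_of_lt_one (norm_nonneg q) hq).mul_right C)
    (tendsto_durfeeTerm hq) (Eventually.of_forall hC)
  simp only [hconst, tsum_ite_eq] at hlim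
  rw [← tendsto_nhds_unique tendsto_const_nhds hlim, ← hconst t]
  exact (summable_durfeeTerm hq t).hasSum

theorem hasSum_durfee_natCast (j s : ℕ) :
    HasSum (fun N : ℕ => q ^ (N ^ 2 + s * N) * (invQFact q (N - j) * invQFact q (N + s + j)))
      (q ^ (j ^ 2 + s * j) * (qPochInf q q)⁻¹) := by
  refine (hasSum_nat_add_iff' j).1 ?_
  rw [sum_eq_zero fun N hN => ?_, sub_zero]
  · refine ((hasSum_durfeeTerm hq (2 * j + s)).mul_left (q ^ (j ^ 2 + s * j))).congr_fun
      fun M => ?_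
    rw [durfeeTerm, Nat.cast_add, add_sub_cancel_right, invQFact_natCast,
      show (M + j + s + j : ℤ) = (M + (2 * j + s) : ℕ) by push_cast; ring, invQFact_natCast]
    ring
  · rw [invQFact_of_neg q (sub_neg.2 (by exact_mod_cast mem_range.1 hN)), zero_mul, mul_zero]

theorem hasSum_durfee {j : ℤ} {s : ℕ} (hj : 0 ≤ j ∨ j + s ≤ 0) :
    HasSum (fun N : ℕ => q ^ (N ^ 2 + s * N) * (invQFact q (N - j) * invQFact q (N + s + j)))
      (q ^ (j ^ 2 + s * j) * (qPochInf q q)⁻¹) := by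
  rcases hj with hj | hj
  · lift j to ℕ using hj
    exact_mod_cast hasSum_durfee_natCast hq j s
  · obtain ⟨k, rfl⟩ : ∃ k : ℕ, j = -k - s := ⟨(-j - s).toNat, by lia⟩
    have hexp : (-k - s : ℤ) ^ 2 + s * (-k - s) = (k ^ 2 + s * k : ℕ) := by
      push_cast
      ring
    rw [hexp, zpow_natCast]
    refine (hasSum_durfee_natCast hq k s).congr_fun fun N => ?_
    rw [mul_comm (invQFact q (N - k))]
    congr 3 <;> ring

end Durfee

theorem hasSum_of_hasSum_sum_antidiagonal {f : ℕ × ℕ → ℂ} {S : ℂ} (hf : Summable f)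
    (hS : HasSum (fun N => ∑ p ∈ antidiagonal N, f p) S) : HasSum f S := by
  have hdiagonals := (HasAntidiagonal.sigmaAntidiagonalEquivProd.hasSum_iff.2 hf.hasSum).sigma
    fun N => hasSum_fintype _
  rw [hS.unique (hdiagonals.congr_fun fun N => (sum_coe_sort (antidiagonal N) f).symm)]
  exact hf.hasSum

section BaileyLimit

variable {ι : Type*} {q : ℂ} {s : ℕ} {j : ι → ℤ} {α : ι → ℂ} {β : ℕ → ℂ}
  (h : IsBaileyPair q s j α β) (hq : ‖q‖ < 1)

theorem summable_baileyKernel (hq : ‖q‖ < 1) (s : ℕ) (j : ι → ℤ) (hα : Summable α) :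
    Summable fun p : ι × ℕ => α p.1 *
      (q ^ (p.2 ^ 2 + s * p.2) * (invQFact q (p.2 - j p.1) * invQFact q (p.2 + s + j p.1))) := by
  obtain ⟨C, hC0, hC⟩ := exists_norm_invQFact_le hq
  have hgeometric := (summable_geometric_of_lt_one (norm_nonneg q) hq).mul_right (C * C)
  refine .of_norm_bounded (hα.norm.mul_of_nonneg hgeometric (fun i => norm_nonneg _)
    fun N => by positivity) fun p => ?_
  rw [norm_mul, norm_mul, norm_mul]
  gcongr
  exacts [norm_pow_le_pow hq (by nlinarith), hC _, hC _]

include h hq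

theorem IsBaileyPair.hasSum_limit (hj : ∀ i, 0 ≤ j i ∨ j i + s ≤ 0) (hα : Summable α) {S : ℂ}
    (hS : HasSum (fun i => α i * q ^ (j i ^ 2 + s * j i)) S) :
    HasSum (fun N : ℕ => q ^ (N ^ 2 + s * N) * β N) (S / qPochInf q q) := by
  have hsum := (summable_baileyKernel hq s j hα).hasSum
  have hrows := hsum.prod_fiberwise fun i => (hasSum_durfee hq (hj i)).mul_left (α i)
  have hcols := ((Equiv.prodComm ℕ ι).hasSum_iff.2 hsum).prod_fiberwise fun N =>
    ((h N).mul_left (q ^ (N ^ 2 + s * N))).congr_fun fun i => mul_left_comm _ _ _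
  have hS' := hS.mul_right (qPochInf q q)⁻¹
  simp only [mul_assoc] at hS'
  rwa [hrows.unique hS', ← div_eq_mul_inv] at hcols

theorem IsBaileyPair.exists_norm_le (hα : Summable α) : ∃ B, ∀ r, ‖β r‖ ≤ B := by
  obtain ⟨C, hC0, hC⟩ := exists_norm_invQFact_le hq
  refine ⟨_, fun r => (h r).norm_le_of_bounded (hα.norm.mul_right (C * C)).hasSum fun i => ?_⟩
  rw [norm_mul, norm_mul]
  gcongr
  exacts [hC _, hC _]

omit h in
theorem summable_changeBaseTerm (s : ℕ) (hβ : ∃ B, ∀ r, ‖β r‖ ≤ B) :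
    Summable fun p : ℕ × ℕ =>
      (q ^ 2) ^ ((p.1 + p.2) ^ 2 + s * (p.1 + p.2)) * changeBaseTerm q s β p := by
  have hq2 := norm_pow_lt_one hq two_ne_zero
  have hneg : ‖-q‖ < 1 := by rwa [norm_neg]
  obtain ⟨B, hB⟩ := hβ
  obtain ⟨C, hC⟩ := exists_norm_inv_qPoch_le hq2 hq2
  obtain ⟨D, hD⟩ := exists_norm_inv_qPoch_le hneg hq
  have hC0 : 0 ≤ C := (norm_nonneg _).trans (hC 0)
  have hD0 : 0 ≤ D := (norm_nonneg _).trans (hD 0)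
  have hgeometric := summable_geometric_of_lt_one (norm_nonneg q) hq
  refine .of_norm_bounded ((hgeometric.mul_of_nonneg hgeometric (fun n => by positivity)
    fun r => by positivity).mul_right (C * D * B)) fun p => ?_
  have hpow : ‖(q ^ 2) ^ ((p.1 + p.2) ^ 2 + s * (p.1 + p.2))‖ ≤ ‖q‖ ^ p.1 * ‖q‖ ^ p.2 := by
    rw [← pow_mul, ← pow_add]
    exact norm_pow_le_pow hq (by nlinarith)
  have hsq : ‖q ^ p.1 ^ 2‖ ≤ 1 := by simpa using norm_pow_le_pow hq (p.1 ^ 2).zero_le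
  rw [changeBaseTerm, norm_mul, norm_mul, norm_mul, norm_mul, norm_mul, norm_pow (-1), norm_neg,
    norm_one, one_pow, one_mul]
  have hterm : ‖q ^ p.1 ^ 2‖ * ‖(qPoch (q ^ 2) (q ^ 2) p.1)⁻¹‖ ≤ C :=
    (mul_le_of_le_one_left (norm_nonneg _) hsq).trans (hC _)
  gcongr
  exacts [hD _, hB _]

theorem IsBaileyPair.hasSum_changeBaseTerm (h0 : q ≠ 0) (hj : ∀ i, 0 ≤ j i ∨ j i + s ≤ 0)
    (hα : Summable α) {S : ℂ} (hS : HasSum (fun i => α i * (q ^ 2) ^ (j i ^ 2 + s * j i)) S) :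
    HasSum (fun p : ℕ × ℕ =>
        (q ^ 2) ^ ((p.1 + p.2) ^ 2 + s * (p.1 + p.2)) * changeBaseTerm q s β p)
      (S / qPochInf (q ^ 2) (q ^ 2)) := by
  have hlimit := (h.isBaileyPair_changeBase h0 hq hj).hasSum_limit
    (norm_pow_lt_one hq two_ne_zero) hj hα hS
  refine hasSum_of_hasSum_sum_antidiagonal
    (summable_changeBaseTerm hq s (h.exists_norm_le hq hα)) (hlimit.congr_fun fun N => ?_)
  rw [changeBase, mul_sum]
  exact sum_congr rfl fun p hp => by rw [mem_antidiagonal.1 hp]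

end BaileyLimit

/-! ### The double series -/

theorem thetaTerm_mul_zpow_sq {y : ℂ} (hy : y ≠ 0) (p x : ℂ) (i : ℤ) :
    thetaTerm p x i * y ^ (i ^ 2) = thetaTerm (p * y ^ 2) (x * y) i := by
  have hexp : i ^ 2 = 2 * (i * (i - 1) / 2) + i := by
    rw [Int.mul_ediv_cancel' (Int.even_mul_pred_self i).two_dvd]
    ring
  rw [thetaTerm, thetaTerm, hexp, zpow_add₀ hy, zpow_mul, mul_zpow, mul_zpow, zpow_ofNat]
  ring

section DoubleSeries

variable {q x : ℂ} (h0 : q ≠ 0) (hq : ‖q‖ < 1) (hx : x ≠ 0)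

include h0 hq hx

theorem hasSum_changeBaseTerm_finiteTheta {d s : ℕ} (hd : 0 < d) (hs : s ≤ d) :
    HasSum (fun p : ℕ × ℕ => (q ^ 2) ^ ((p.1 + p.2) ^ 2 + s * (p.1 + p.2)) *
        changeBaseTerm q s (fun r => finiteTheta d q x r (r + s)) p)
      (qPochInf₃ (x * q ^ (2 * d ^ 2 + 2 * s * d))
          (q ^ (d + 4 * d ^ 2) / (x * q ^ (2 * d ^ 2 + 2 * s * d)))
          (q ^ (d + 4 * d ^ 2)) (q ^ (d + 4 * d ^ 2)) / qPochInf (q ^ 2) (q ^ 2)) := by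
  have hj (i : ℤ) : 0 ≤ d * i ∨ d * i + s ≤ 0 := by
    have hd' : (0 : ℤ) < d := by exact_mod_cast hd
    have hs' : (s : ℤ) ≤ d := by exact_mod_cast hs
    rcases le_or_gt 0 i with hi | hi
    · exact .inl (mul_nonneg hd'.le hi)
    · exact .inr (by nlinarith [hd', hs'])
  refine (isBaileyPair_finiteTheta hd q x s).hasSum_changeBaseTerm hq h0 hj
    (summable_norm_thetaTerm (pow_ne_zero d h0) (norm_pow_lt_one hq hd.ne') hx).of_norm ?_
  have htheta := jacobi_triple_product (x := x * q ^ (2 * d ^ 2 + 2 * s * d))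
    (pow_ne_zero (d + 4 * d ^ 2) h0) (norm_pow_lt_one hq (by positivity))
    (mul_ne_zero hx (pow_ne_zero _ h0))
  refine htheta.congr_fun fun i => ?_
  rw [show (d * i : ℤ) ^ 2 + s * (d * i) = (d ^ 2 : ℕ) * i ^ 2 + (s * d : ℕ) * i by
      push_cast; ring, zpow_add₀ (pow_ne_zero 2 h0), zpow_mul, zpow_mul, zpow_natCast,
    zpow_natCast, ← mul_assoc, thetaTerm_mul_zpow_sq (pow_ne_zero _ (pow_ne_zero 2 h0)),
    thetaTerm_mul_zpow]
  congr 1 <;> ring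

end DoubleSeries

/-! ### The four identities -/

theorem sq_eq_two_mul_choose_two_add_self (r : ℕ) : r ^ 2 = 2 * r.choose 2 + r := by
  induction r with
  | zero => rfl
  | succ r ih =>
    rw [Nat.choose_succ_succ' r 1, Nat.choose_one_right]
    linarith

theorem hasSum_one_of_eq_zero {f : ℕ × ℕ → ℂ} (hf : f (0, 0) = 1)
    (hfst : ∀ n r, n ≠ 0 → f (n, r) = 0) (hsnd : ∀ r, r ≠ 0 → f (0, r) = 0) : HasSum f 1 := by
  refine hf ▸ hasSum_single (0, 0) fun ⟨n, r⟩ hp => ?_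
  rcases eq_or_ne n 0 with rfl | hn
  · exact hsnd r fun hr => hp (by rw [hr])
  · exact hfst n r hn

theorem qPochInf₃_zero_pow_div {a b c d e f : ℕ} (ha : a ≠ 0) (hb : b ≠ 0) (hc : c ≠ 0)
    (he : e ≠ 0) : qPochInf₃ (0 ^ a) (0 ^ b) (0 ^ c) (0 ^ d) / qPochInf (0 ^ e) (0 ^ f) = 1 := by
  simp [qPochInf₃, qPochInf_zero_left, ha, hb, hc, he]

theorem rogers_ramanujan_mod_eighteen_two (q : ℂ) (hq : ‖q‖ < 1) :
    HasSum (fun p : ℕ × ℕ =>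
        let n := p.1
        let r := p.2
        (-1) ^ n * q ^ (3 * n ^ 2 + 4 * n + 4 * n * r + (5 * r ^ 2 + 7 * r) / 2) /
          (qPoch (-q) q (2 * n + 2 * r + 2) * qPoch q q r *
            qPoch q (q ^ 2) (r + 1) * qPoch (q ^ 2) (q ^ 2) n))
      (qPochInf₃ (q ^ 2) (q ^ 16) (q ^ 18) (q ^ 18) / qPochInf (q ^ 2) (q ^ 2)) := by
  have hexp (r : ℕ) : (5 * r ^ 2 + 7 * r) / 2 = 5 * r.choose 2 + 6 * r := by
    rw [sq_eq_two_mul_choose_two_add_self]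
    lia
  simp only [hexp]
  rcases eq_or_ne q 0 with rfl | h0
  · rw [qPochInf₃_zero_pow_div (by simp) (by simp) (by simp) (by simp)]
    refine hasSum_one_of_eq_zero (by simp [qPoch]) (fun n r hn => ?_) fun r hr => ?_ <;>
      simp only <;> rw [zero_pow (by positivity)] <;> simp
  have hsum := hasSum_changeBaseTerm_finiteTheta h0 hq one_ne_zero two_pos (le_refl 2)
  norm_num only at hsum
  rw [one_mul, show q ^ 18 / q ^ 16 = q ^ 2 by field_simp, qPochInf₃_swap] at hsum
  refine hsum.congr_fun fun ⟨n, r⟩ => ?_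
  have hr := sq_eq_two_mul_choose_two_add_self r
  simp only [changeBaseTerm, finiteTheta_two_one_add_two_eq h0 hq]
  rw [show 3 * n ^ 2 + 4 * n + 4 * n * r + (5 * r.choose 2 + 6 * r) =
      2 * ((n + r) ^ 2 + 2 * (n + r)) + n ^ 2 + r.choose 2 by linarith,
    pow_add, pow_add, pow_mul, ← mul_add, div_eq_mul_inv, mul_inv, mul_inv, mul_inv, mul_inv]
  ring

theorem rogers_ramanujan_mod_eighteen_four (q : ℂ) (hq : ‖q‖ < 1) :
    HasSum (fun p : ℕ × ℕ =>
        let n := p.1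
        let r := p.2
        (-1) ^ n * q ^ (3 * n ^ 2 + 4 * n + 4 * n * r + (5 * r ^ 2 + 3 * r) / 2) *
            (q ^ (2 * r + 2) - q + q ^ r + q ^ (r + 1)) /
          (qPoch (-q) q (2 * n + 2 * r + 2) * qPoch q q r *
            qPoch q (q ^ 2) (r + 1) * qPoch (q ^ 2) (q ^ 2) n))
      (qPochInf₃ (q ^ 4) (q ^ 14) (q ^ 18) (q ^ 18) / qPochInf (q ^ 2) (q ^ 2)) := by
  have hexp (r : ℕ) : (5 * r ^ 2 + 3 * r) / 2 = 5 * r.choose 2 + 4 * r := by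
    rw [sq_eq_two_mul_choose_two_add_self]
    lia
  simp only [hexp]
  rcases eq_or_ne q 0 with rfl | h0
  · rw [qPochInf₃_zero_pow_div (by simp) (by simp) (by simp) (by simp)]
    refine hasSum_one_of_eq_zero (by simp [qPoch]) (fun n r hn => ?_) fun r hr => ?_ <;>
      simp only <;> rw [zero_pow (by positivity)] <;> simp
  have hsum := hasSum_changeBaseTerm_finiteTheta h0 hq (one_div_ne_zero (pow_ne_zero 2 h0))
    two_pos (le_refl 2)
  norm_num only at hsum
  rw [show 1 / q ^ 2 * q ^ 16 = q ^ 14 by field_simp, show q ^ 18 / q ^ 14 = q ^ 4 by field_simp,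
    qPochInf₃_swap] at hsum
  refine hsum.congr_fun fun ⟨n, r⟩ => ?_
  have hr := sq_eq_two_mul_choose_two_add_self r
  have hpow : q ^ (3 * n ^ 2 + 4 * n + 4 * n * r + (5 * r.choose 2 + 4 * r)) =
      (q ^ 2) ^ ((n + r) ^ 2 + 2 * (n + r)) * q ^ n ^ 2 * q ^ r.choose 2 / q ^ (2 * r) := by
    rw [eq_div_iff (pow_ne_zero _ h0), ← pow_mul, ← pow_add, ← pow_add, ← pow_add]
    congr 1
    linarith
  simp only [changeBaseTerm, finiteTheta_two_inv_sq_add_two_eq h0 hq]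
  rw [hpow, ← mul_add, div_eq_mul_inv, div_eq_mul_inv, div_eq_mul_inv, mul_inv, mul_inv, mul_inv,
    mul_inv]
  ring

theorem rogers_ramanujan_mod_eighteen_six (q : ℂ) (hq : ‖q‖ < 1) :
    HasSum (fun p : ℕ × ℕ =>
        let n := p.1
        let r := p.2
        (-1) ^ n * q ^ (3 * n ^ 2 + 4 * n * r + (5 * r ^ 2 - 5 * r) / 2) *
            (q ^ r + q ^ (r + 1) - q) /
          (qPoch (-q) q (2 * n + 2 * r) * qPoch q q r *
            qPoch q (q ^ 2) r * qPoch (q ^ 2) (q ^ 2) n))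
      (qPochInf (q ^ 6) (q ^ 6) / qPochInf (q ^ 2) (q ^ 2)) := by
  have hexp (r : ℕ) : (5 * r ^ 2 - 5 * r) / 2 = 5 * r.choose 2 := by
    rw [sq_eq_two_mul_choose_two_add_self]
    lia
  have htheta : qPochInf (q ^ 6) (q ^ 6) = qPochInf₃ (q ^ 6) (q ^ 12) (q ^ 18) (q ^ 18) := by
    rw [qPochInf_trisect (q ^ 6) (norm_pow_lt_one hq (by simp))]
    ring_nf
  simp only [hexp, htheta]
  rcases eq_or_ne q 0 with rfl | h0
  · rw [qPochInf₃_zero_pow_div (by simp) (by simp) (by simp) (by simp)]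
    refine hasSum_one_of_eq_zero (by simp [qPoch]) (fun n r hn => ?_) fun r hr => ?_
    · simp only
      rw [zero_pow (by positivity)]
      simp
    · simp [hr]
  have hsum := hasSum_changeBaseTerm_finiteTheta h0 hq (one_div_ne_zero (pow_ne_zero 2 h0))
    two_pos zero_le_two
  norm_num only at hsum
  rw [show 1 / q ^ 2 * q ^ 8 = q ^ 6 by field_simp, show q ^ 18 / q ^ 6 = q ^ 12 by field_simp]
    at hsum
  refine hsum.congr_fun fun ⟨n, r⟩ => ?_
  have hr := sq_eq_two_mul_choose_two_add_self r
  have hpow : q ^ (3 * n ^ 2 + 4 * n * r + 5 * r.choose 2) =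
      (q ^ 2) ^ (n + r) ^ 2 * q ^ n ^ 2 * q ^ r.choose 2 / q ^ (2 * r) := by
    rw [eq_div_iff (pow_ne_zero _ h0), ← pow_mul, ← pow_add, ← pow_add, ← pow_add]
    congr 1
    linarith
  simp only [changeBaseTerm, add_zero, zero_mul, finiteTheta_two_inv_sq_self_eq h0 hq]
  rw [hpow, ← mul_add, div_eq_mul_inv, div_eq_mul_inv, div_eq_mul_inv, mul_inv, mul_inv, mul_inv,
    mul_inv]
  ring

theorem rogers_ramanujan_mod_eighteen_eight (q : ℂ) (hq : ‖q‖ < 1) :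
    HasSum (fun p : ℕ × ℕ =>
        let n := p.1
        let r := p.2
        (-1) ^ n * q ^ (3 * n ^ 2 + 4 * n * r + (5 * r ^ 2 - r) / 2) /
          (qPoch (-q) q (2 * n + 2 * r) * qPoch q q r *
            qPoch q (q ^ 2) r * qPoch (q ^ 2) (q ^ 2) n))
      (qPochInf₃ (q ^ 8) (q ^ 10) (q ^ 18) (q ^ 18) / qPochInf (q ^ 2) (q ^ 2)) := by
  have hexp (r : ℕ) : (5 * r ^ 2 - r) / 2 = 5 * r.choose 2 + 2 * r := by
    rw [sq_eq_two_mul_choose_two_add_self]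
    lia
  simp only [hexp]
  rcases eq_or_ne q 0 with rfl | h0
  · rw [qPochInf₃_zero_pow_div (by simp) (by simp) (by simp) (by simp)]
    refine hasSum_one_of_eq_zero (by simp [qPoch]) (fun n r hn => ?_) fun r hr => ?_ <;>
      simp only <;> rw [zero_pow (by positivity)] <;> simp
  have hsum := hasSum_changeBaseTerm_finiteTheta h0 hq one_ne_zero two_pos zero_le_two
  norm_num only at hsum
  rw [one_mul, show q ^ 18 / q ^ 8 = q ^ 10 by field_simp] at hsum
  refine hsum.congr_fun fun ⟨n, r⟩ => ?_
  have hr := sq_eq_two_mul_choose_two_add_self r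
  simp only [changeBaseTerm, add_zero, zero_mul, finiteTheta_two_one_self_eq h0 hq]
  rw [show 3 * n ^ 2 + 4 * n * r + (5 * r.choose 2 + 2 * r) =
      2 * (n + r) ^ 2 + n ^ 2 + r.choose 2 by linarith,
    pow_add, pow_add, pow_mul, ← mul_add, div_eq_mul_inv, mul_inv, mul_inv, mul_inv, mul_inv]
  ring

/- The halved exponents are exact: `5r² + 7r`, `5r² + 3r`, `5r² - 5r`, `5r² - r` are even
natural numbers for every natural number `r`. -/
theorem mainTheorem8 (q : ℂ) (hq : ‖q‖ < 1) :
    HasSum (fun p : ℕ × ℕ =>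
        let n := p.1
        let r := p.2
        (-1) ^ n * q ^ (3 * n ^ 2 + 4 * n + 4 * n * r + (5 * r ^ 2 + 7 * r) / 2) /
          (qPoch (-q) q (2 * n + 2 * r + 2) * qPoch q q r *
            qPoch q (q ^ 2) (r + 1) * qPoch (q ^ 2) (q ^ 2) n))
      (qPochInf₃ (q ^ 2) (q ^ 16) (q ^ 18) (q ^ 18) / qPochInf (q ^ 2) (q ^ 2)) ∧
    HasSum (fun p : ℕ × ℕ =>
        let n := p.1
        let r := p.2
        (-1) ^ n * q ^ (3 * n ^ 2 + 4 * n + 4 * n * r + (5 * r ^ 2 + 3 * r) / 2) *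
            (q ^ (2 * r + 2) - q + q ^ r + q ^ (r + 1)) /
          (qPoch (-q) q (2 * n + 2 * r + 2) * qPoch q q r *
            qPoch q (q ^ 2) (r + 1) * qPoch (q ^ 2) (q ^ 2) n))
      (qPochInf₃ (q ^ 4) (q ^ 14) (q ^ 18) (q ^ 18) / qPochInf (q ^ 2) (q ^ 2)) ∧
    HasSum (fun p : ℕ × ℕ =>
        let n := p.1
        let r := p.2
        (-1) ^ n * q ^ (3 * n ^ 2 + 4 * n * r + (5 * r ^ 2 - 5 * r) / 2) *
            (q ^ r + q ^ (r + 1) - q) /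
          (qPoch (-q) q (2 * n + 2 * r) * qPoch q q r *
            qPoch q (q ^ 2) r * qPoch (q ^ 2) (q ^ 2) n))
      (qPochInf (q ^ 6) (q ^ 6) / qPochInf (q ^ 2) (q ^ 2)) ∧
    HasSum (fun p : ℕ × ℕ =>
        let n := p.1
        let r := p.2
        (-1) ^ n * q ^ (3 * n ^ 2 + 4 * n * r + (5 * r ^ 2 - r) / 2) /
          (qPoch (-q) q (2 * n + 2 * r) * qPoch q q r *
            qPoch q (q ^ 2) r * qPoch (q ^ 2) (q ^ 2) n))
      (qPochInf₃ (q ^ 8) (q ^ 10) (q ^ 18) (q ^ 18) / qPochInf (q ^ 2) (q ^ 2)) :=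
  ⟨rogers_ramanujan_mod_eighteen_two q hq, rogers_ramanujan_mod_eighteen_four q hq,
    rogers_ramanujan_mod_eighteen_six q hq, rogers_ramanujan_mod_eighteen_eight q hq⟩
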